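/- \textbf{Theorem (Uniform Convergence Theorem).} Let $N$ agents have a finite behavior space $\mathbb B$ and a finite feedback space $\mathbb H$, let $\mathbb U$ be a measurable space of user factors with a probability law $\nu$, let $\eta=(\eta_1,\dots,\eta_N):\mathbb U\times\mathbb B^N\to\mathbb H^N$ be a feedback function measurable in its first argument, and let $P_i(\cdot\mid b;h)$ be, for each agent $i$, $b\in\mathbb B$ and $h\in\mathbb H$, a probability distribution on $\mathbb B$. Write $M_k(x,y)=\prod_{i=1}^N P_i(y^i\mid x^i;k^i)$ for $k\in\mathbb H^N$, $x,y\in\mathbb B^N$. Let $(u_t)_{t\ge 0}$ and $(b_t)_{t\ge 0}$ be random variables with values in $\mathbb U$ and $\mathbb B^N$ such that each $u_t$ has law $\nu$ and is independent of $(b_0,\dots,b_t,u_0,\dots,u_{t-1})$ (so the $u_t$ are i.i.d.), and, with $h_t=\eta(u_t,b_t)$, $$P(b_{t+1}=y\mid b_0,\dots,b_t;u_0,\dots,u_t)=M_{h_t}(b_t,y)\quad\text{almost surely, for all } y\in\mathbb B^N .$$ The lifted chain is $z_t=(h_t,b_t,b_{t+1})$, $t\ge 0$, a Markov chain on $\mathcal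 Z=\mathbb H^N\times\mathbb B^{N}\times\mathbb B^N$ whose transition probability from $(j,p,q)$ to $(k,x,y)$ is $\nu\{u:\eta(u,x)=k\}\,M_k(x,y)$ if $x=q$ and $0$ otherwise. Suppose that it is stationary: $\pi$ is a stationary distribution of this transition matrix and $z_0$ has law $\pi$. Let $\mathcal F$ be a set of functions $f:\mathbb H^N\times\mathbb B^N\to\mathbb B^N$ and let $l:\mathbb B^N\times\mathbb B^N\to\mathbb R$ be a loss. Write $l(f,z)=l(f(h,b),b')$ for $z=(h,b,b')\in\mathcal Z$, and suppose that $|l(f,z)|\le B$ for all $f\in\mathcal F$ and $z\in\mathcal Z$, where $B>0$. Put $$err_S^T(f)=\frac1T\sum_{t=1}^T l(f,z_t),\qquad err_\pi(f)=E_\pi\, l(f,z).$$ Let $\mathcal N(\epsilon,l\circ\mathcal F,T)$ be the maximum over $(x_1,\dots,x_T)\in\mathcal Z^T$ of the smallest number of elements of a subset $C$ of $A=\{(l(f,x_1),\dots,l(f,x_T)):f\in\mathcal F\}\subset\mathbb R^T$ such that every point of $A$ is within distance $\epsilon$ of $C$ in the metric $d_T(v,w)=\max_{1\le t\le T}|v_t-w_t|$.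 Let $\beta(z,m)$ be the $\beta$-mixing coefficient of $(z_t)$, $$\beta(z,m)=\sup_{k\ge 0}\ \sup\ \frac12\sum_{i,j}\bigl|P(A_i\cap C_j)-P(A_i)P(C_j)\bigr|,$$ where the inner supremum is over all finite partitions $(A_i)$ of the probability space into sets of $\sigma(z_s:s\le k)$ and $(C_j)$ into sets of $\sigma(z_s:s\ge k+m)$. Then for every $\epsilon>0$ and all positive integers $m,\tau,T$ with $2\tau m=T$, $$P\Bigl(\sup_{f\in\mathcal F}\bigl|err_S^T(f)-err_\pi(f)\bigr|\ge\epsilon\Bigr)\le 16\,\mathcal N(\epsilon/16,\,l\circ\mathcal F,\,T)\,\exp\Bigl(-\frac{\epsilon^2\tau}{128B^2}\Bigr)+2\tau\,\beta(z,m).$$ (If $\mathcal F$ is empty, the supremum is read as $0$.) -/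

import Mathlib

open MeasureTheory ProbabilityTheory
open scoped NNReal ENNReal

namespace ABP

/-- States `(h_t, b_t, b_{t+1})` of the lifted chain: joint feedback, joint behavior, and next joint
behavior of `N` agents with behavior space `𝔹` and feedback space `ℍ`. -/
abbrev State (N : ℕ) (𝔹 ℍ : Type*) : Type _ :=
  (Fin N → ℍ) × (Fin N → 𝔹) × (Fin N → 𝔹)

/-- Behavior prediction functions: current joint feedback and behavior to next joint behavior. -/
abbrev Predictor (N : ℕ) (𝔹 ℍ : Type*) : Type _ :=
  (Fin N → ℍ) × (Fin N → 𝔹) → (Fin N → 𝔹)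

/-- Joint feedback `η(u, b)`, given the feedback functions `η i` of the single agents. -/
def jointFeedback {N : ℕ} {𝔹 ℍ U : Type*} (η : Fin N → U → (Fin N → 𝔹) → ℍ)
    (u : U) (b : Fin N → 𝔹) : Fin N → ℍ :=
  fun i => η i u b

/-- The joint transition probability `M_k(m, n) = ∏ i, P_i(n i | m i; k i)`: given the feedback, the
agents move independently, agent `i` according to `p i (feedback) (current behavior)`. -/
noncomputable def jointTransition {N : ℕ} {𝔹 ℍ : Type*} (p : Fin N → ℍ → 𝔹 → PMF 𝔹)
    (k : Fin N → ℍ) (m n : Fin N → 𝔹) : ℝ :=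
  ∏ i, (p i (k i) (m i) (n i)).toReal

open Classical in
/-- One-step transition matrix of the lifted chain: from `(j, p, q)` to `(k, m, n)` it is
`ν {u | η(u, m) = k} * M_k(m, n)` if `m = q`, and `0` otherwise. -/
noncomputable def liftedMatrix {N : ℕ} {𝔹 ℍ U : Type*} [MeasurableSpace U]
    (ν : Measure U) (η : Fin N → U → (Fin N → 𝔹) → ℍ) (p : Fin N → ℍ → 𝔹 → PMF 𝔹) :
    Matrix (State N 𝔹 ℍ) (State N 𝔹 ℍ) ℝ :=
  fun x y =>
    if y.2.1 = x.2.2 then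
      ν.real {u | jointFeedback η u y.2.1 = y.1} * jointTransition p y.1 y.2.1 y.2.2
    else 0

/-- `π` is a probability vector with `π M = π`. -/
def IsStationaryDistribution {S : Type*} [Fintype S] (M : Matrix S S ℝ) (π : S → ℝ) : Prop :=
  π ∈ stdSimplex ℝ S ∧ Matrix.vecMul π M = π

/-- The σ-algebra generated by the variables `X s` with `P s`. -/
@[reducible] def sigmaOf {Ω E : Type*} [MeasurableSpace E] (X : ℕ → Ω → E) (P : ℕ → Prop) :
    MeasurableSpace Ω :=
  ⨆ (s : ℕ) (_ : P s), MeasurableSpace.comap (X s) inferInstance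

/-- The agents' joint behaviors `b t`, `t ≥ 0`, form a Markov chain in the random environment driven
by the user factors `u t`:
the `u t` all have law `ν`, each `u t` is independent of the past `b_0, …, b_t, u_0, …, u_{t-1}`
(in particular the `u t` are i.i.d.), and conditionally on `b_0, …, b_t, u_0, …, u_t` the next joint
behavior `b_{t+1}` is distributed according to `M_{h_t}(b_t, ·)`, where `h_t = η(u_t, b_t)`. -/
structure IsMCRE {N : ℕ} {𝔹 ℍ U Ω : Type*} [MeasurableSpace 𝔹] [MeasurableSpace U]
    [MeasurableSpace Ω] (μ : Measure Ω) (ν : Measure U)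
    (η : Fin N → U → (Fin N → 𝔹) → ℍ) (p : Fin N → ℍ → 𝔹 → PMF 𝔹)
    (u : ℕ → Ω → U) (b : ℕ → Ω → Fin N → 𝔹) : Prop where
  measurable_u : ∀ t, Measurable (u t)
  measurable_b : ∀ t, Measurable (b t)
  law_u : ∀ t, μ.map (u t) = ν
  indep_u : ∀ t, Indep (MeasurableSpace.comap (u t) inferInstance)
    (sigmaOf b (fun s => s ≤ t) ⊔ sigmaOf u (fun s => s < t)) μ
  transition : ∀ (t : ℕ) (n : Fin N → 𝔹),
    μ[Set.indicator {ω | b (t + 1) ω = n} (fun _ => (1 : ℝ)) |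
        sigmaOf b (fun s => s ≤ t) ⊔ sigmaOf u (fun s => s ≤ t)]
      =ᵐ[μ] fun ω => jointTransition p (jointFeedback η (u t ω) (b t ω)) (b t ω) n

/-- The lifted chain `z_t = (h_t, b_t, b_{t+1})` with `h_t = η(u_t, b_t)`. -/
def lifted {N : ℕ} {𝔹 ℍ U Ω : Type*} (η : Fin N → U → (Fin N → 𝔹) → ℍ)
    (u : ℕ → Ω → U) (b : ℕ → Ω → Fin N → 𝔹) (t : ℕ) (ω : Ω) : State N 𝔹 ℍ :=
  (jointFeedback η (u t ω) (b t ω), b t ω, b (t + 1) ω)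

/-- `l(f, z) = l(f(h, b), b')` at the state `z = (h, b, b')`. -/
def lossAt {N : ℕ} {𝔹 ℍ : Type*} (l : (Fin N → 𝔹) → (Fin N → 𝔹) → ℝ)
    (f : Predictor N 𝔹 ℍ) (z : State N 𝔹 ℍ) : ℝ :=
  l (f (z.1, z.2.1)) z.2.2

/-- Empirical risk `(1/T) ∑_{t=1}^T l(f, z_t)`. -/
noncomputable def empiricalRisk {N : ℕ} {𝔹 ℍ : Type*} (l : (Fin N → 𝔹) → (Fin N → 𝔹) → ℝ)
    (T : ℕ) (z : ℕ → State N 𝔹 ℍ) (f : Predictor N 𝔹 ℍ) : ℝ :=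
  (1 / (T : ℝ)) * ∑ t ∈ Finset.Icc 1 T, lossAt l f (z t)

/-- Expected risk `E_π l(f, z)`. -/
noncomputable def expectedRisk {N : ℕ} {𝔹 ℍ : Type*} [Fintype 𝔹] [Fintype ℍ]
    (l : (Fin N → 𝔹) → (Fin N → 𝔹) → ℝ) (π : State N 𝔹 ℍ → ℝ) (f : Predictor N 𝔹 ℍ) : ℝ :=
  ∑ z, π z * lossAt l f z

/-- The projection of `l ∘ F` on the data `z_1, …, z_T`, a subset of `ℝ^T`. The metric of
`Fin T → ℝ` is the maximum metric. -/
def lossProjection {N : ℕ} {𝔹 ℍ : Type*} (l : (Fin N → 𝔹) → (Fin N → 𝔹) → ℝ)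
    (F : Set (Predictor N 𝔹 ℍ)) {T : ℕ} (z : Fin T → State N 𝔹 ℍ) : Set (Fin T → ℝ) :=
  (fun f t => lossAt l f (z t)) '' F

/-- The empirical `ℓ_∞` covering number: the maximum over all data `z_1, …, z_T` of the minimal
cardinality of an `ε`-cover of the projection of `l ∘ F` on the data. -/
noncomputable def empCoveringNumber {N : ℕ} {𝔹 ℍ : Type*} (ε : ℝ)
    (l : (Fin N → 𝔹) → (Fin N → 𝔹) → ℝ) (F : Set (Predictor N 𝔹 ℍ)) (T : ℕ) : ℕ :=
  (⨆ z : Fin T → State N 𝔹 ℍ, Metric.coveringNumber ε.toNNReal (lossProjection l F z)).toNat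

/-- The supremum defining `empCoveringNumber` is finite, so that no information is lost in the
passage to `ℕ`. -/
theorem coe_empCoveringNumber {N : ℕ} {𝔹 ℍ : Type*} [Finite 𝔹] [Finite ℍ] (ε : ℝ)
    (l : (Fin N → 𝔹) → (Fin N → 𝔹) → ℝ) (F : Set (Predictor N 𝔹 ℍ)) (T : ℕ) :
    (empCoveringNumber ε l F T : ℕ∞) =
      ⨆ z : Fin T → State N 𝔹 ℍ, Metric.coveringNumber ε.toNNReal (lossProjection l F z) := by
  refine ENat.natCast_toNat (ne_top_of_le_ne_top (b := F.encard) ?_ ?_)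
  · exact Set.encard_ne_top_iff.2 F.toFinite
  · exact iSup_le fun z =>
      (Metric.coveringNumber_le_encard_self _).trans (Set.encard_image_le _ _)

/-- `A` is a finite partition of `Ω` into sets of the σ-algebra `𝒜`. -/
def IsMeasPartition {Ω : Type*} (𝒜 : MeasurableSpace Ω) {I : ℕ} (A : Fin I → Set Ω) : Prop :=
  (∀ i, MeasurableSet[𝒜] (A i)) ∧ Pairwise (fun i j => Disjoint (A i) (A j)) ∧
    ⋃ i, A i = Set.univ

/-- The values `(1/2) ∑_{i,j} |μ (A_i ∩ C_j) - μ A_i * μ C_j|` over all finite partitions `A`, `C`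
into sets of `𝒜` and of `ℬ` respectively. -/
def betaSums {Ω : Type*} (𝒜 ℬ : MeasurableSpace Ω) {mΩ : MeasurableSpace Ω}
    (μ : Measure Ω) : Set ℝ :=
  {x | ∃ (I J : ℕ) (A : Fin I → Set Ω) (C : Fin J → Set Ω),
    IsMeasPartition 𝒜 A ∧ IsMeasPartition ℬ C ∧
    x = (1 / 2) * ∑ i, ∑ j, |μ.real (A i ∩ C j) - μ.real (A i) * μ.real (C j)|}

/-- For sub-σ-algebras `𝒜`, `ℬ` all these values are at most `1`, so the suprema below are suprema of
bounded sets. -/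
theorem le_one_of_mem_betaSums {Ω : Type*} {𝒜 ℬ mΩ : MeasurableSpace Ω} {μ : Measure Ω}
    [IsProbabilityMeasure μ] (h𝒜 : 𝒜 ≤ mΩ) (hℬ : ℬ ≤ mΩ) {x : ℝ} (hx : x ∈ betaSums 𝒜 ℬ μ) :
    x ≤ 1 := by
  obtain ⟨I, J, A, C, hA, hC, rfl⟩ := hx
  have hsum : ∀ {K : ℕ} {D : Fin K → Set Ω}, (∀ i, MeasurableSet (D i)) →
      Pairwise (fun i j => Disjoint (D i) (D j)) → ⋃ i, D i = Set.univ →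
      ∀ S : Set Ω, MeasurableSet S → ∑ j, μ.real (S ∩ D j) = μ.real S := by
    intro K D hm hd hu S hS
    rw [← measureReal_iUnion_fintype (fun i j hij =>
      (hd hij).mono Set.inter_subset_right Set.inter_subset_right) (fun j => hS.inter (hm j)),
      ← Set.inter_iUnion, hu, Set.inter_univ]
  have hA' := fun i => h𝒜 _ (hA.1 i)
  have hC' := fun i => hℬ _ (hC.1 i)
  have sA : ∑ i, μ.real (A i) = 1 := by
    simpa using hsum hA' hA.2.1 hA.2.2 Set.univ MeasurableSet.univ
  have sC : ∑ i, μ.real (C i) = 1 := by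
    simpa using hsum hC' hC.2.1 hC.2.2 Set.univ MeasurableSet.univ
  have key : ∑ i, ∑ j, |μ.real (A i ∩ C j) - μ.real (A i) * μ.real (C j)| ≤
      ∑ i, ∑ j, (μ.real (A i ∩ C j) + μ.real (A i) * μ.real (C j)) := by
    refine Finset.sum_le_sum fun i _ => Finset.sum_le_sum fun j _ => ?_
    have h1 : 0 ≤ μ.real (A i ∩ C j) := measureReal_nonneg
    have h2 : 0 ≤ μ.real (A i) * μ.real (C j) := mul_nonneg measureReal_nonneg measureReal_nonneg
    exact abs_le.2 ⟨by linarith, by linarith⟩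
  have e : ∑ i, ∑ j, (μ.real (A i ∩ C j) + μ.real (A i) * μ.real (C j)) = 2 := by
    simp_rw [Finset.sum_add_distrib, ← Finset.mul_sum, sC,
      fun i => hsum hC' hC.2.1 hC.2.2 (A i) (hA' i)]
    simp only [mul_one, sA]
    norm_num
  linarith

/-- The `β`-mixing coefficient (coefficient of absolute regularity) of two σ-algebras. -/
noncomputable def betaCoeff {Ω : Type*} (𝒜 ℬ : MeasurableSpace Ω) {mΩ : MeasurableSpace Ω}
    (μ : Measure Ω) : ℝ :=
  sSup (betaSums 𝒜 ℬ μ)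

/-- The `β`-mixing coefficient of a process at lag `m`: the supremum over `k` of the coefficient of
`σ(X_s, s ≤ k)` and `σ(X_s, s ≥ k + m)`. -/
noncomputable def betaMixing {Ω E : Type*} [MeasurableSpace E] [MeasurableSpace Ω]
    (μ : Measure Ω) (X : ℕ → Ω → E) (m : ℕ) : ℝ :=
  ⨆ k : ℕ, betaCoeff (sigmaOf X (fun s => s ≤ k)) (sigmaOf X (fun s => k + m ≤ s)) μ

end ABP

/-!
The proof reduces the dependent sample to independent blocks and applies the classical
symmetrization argument to them.

Stationarity of `π` and the Markov property give every `z t` the law `π`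
(`ABP.IsMCRE.measureReal_lifted_eq_stationary`); nothing else about the chain is used. The times
`1, …, T` are cut into `2 * τ` consecutive blocks of length `m`. The empirical risk is the mean of
the block averages over the `τ` blocks at odd and the `τ` blocks at even positions, so a
deviation of size `ε` forces one of the same size for one parity. Blocks of one
parity are separated by gaps of length `m`; adding the blocks one at a time shows that
their joint law is within total variation distance `τ * β(z, m)` of the product of their laws
(`ABP.sum_abs_blocks_sub_prod_le`).

Under the product law, the deviation is compared with the difference to an independent ghost sample
(`ABP.sum_deviation_le_two_mul_sum_ghost`, by Chebyshev's inequality), and that difference may be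
given random signs. Sample and ghost sample together consist of `2 * τ * m = T` points, so
the class can be replaced by a cover of radius `ε / 16` with at most `𝒩(ε / 16, l ∘ F, T)`
elements, each of which is controlled by Hoeffding's inequality for Rademacher sums
(`ABP.sum_ghost_le`). Chebyshev's inequality needs `32 * B ^ 2 ≤ τ * ε ^ 2`; otherwise the
right-hand side of the bound exceeds `1`.

All state spaces are finite, so laws are handled as finite families of weights and probabilities
as finite sums.
-/

namespace ABP

/-! ### Rademacher sums -/

/-- The sign of a Boolean, `1` for `true` and `-1` for `false`. -/
def boolSign (s : Bool) : ℝ := if s then 1 else -1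

section Rademacher

variable {ι : Type*} [Fintype ι] [DecidableEq ι]

theorem sum_exp_boolSign (d : ι → ℝ) :
    ∑ σ : ι → Bool, Real.exp (∑ j, boolSign (σ j) * d j) = ∏ j, (2 * Real.cosh (d j)) := by
  simp_rw [Real.exp_sum]
  rw [← Fintype.prod_sum (fun j s => Real.exp (boolSign s * d j))]
  refine Finset.prod_congr rfl fun j _ => ?_
  rw [Fintype.sum_bool, Real.cosh_eq]
  simp [boolSign]
  ring

open Classical in
theorem card_le_sum_boolSign [Nonempty ι] {d : ι → ℝ} {D r : ℝ} (hD : 0 < D) (hr : 0 ≤ r)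
    (hd : ∀ j, |d j| ≤ D) :
    ((Finset.univ.filter fun σ : ι → Bool => r ≤ ∑ j, boolSign (σ j) * d j).card : ℝ) ≤
      2 ^ Fintype.card ι * Real.exp (-r ^ 2 / (2 * Fintype.card ι * D ^ 2)) := by
  have hn : (0 : ℝ) < Fintype.card ι := by exact_mod_cast Fintype.card_pos
  set n : ℝ := (Fintype.card ι : ℝ) with hndef
  -- The minimizer of the exponent `-c * r + n * (c * D) ^ 2 / 2` of the Chernoff bound.
  set c : ℝ := r / (n * D ^ 2) with hc
  have hc0 : 0 ≤ c := by positivity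
  calc ((Finset.univ.filter fun σ : ι → Bool => r ≤ ∑ j, boolSign (σ j) * d j).card : ℝ)
      = ∑ σ : ι → Bool with r ≤ ∑ j, boolSign (σ j) * d j, (1 : ℝ) := by simp
    _ ≤ ∑ σ : ι → Bool with r ≤ ∑ j, boolSign (σ j) * d j,
          Real.exp (-c * r) * Real.exp (∑ j, boolSign (σ j) * (c * d j)) := by
        refine Finset.sum_le_sum fun σ hσ => ?_
        have h := (Finset.mem_filter.1 hσ).2
        rw [← Real.exp_add]
        refine Real.one_le_exp ?_
        have e : ∑ j, boolSign (σ j) * (c * d j) = c * ∑ j, boolSign (σ j) * d j := by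
          rw [Finset.mul_sum]
          exact Finset.sum_congr rfl fun j _ => by ring
        rw [e]
        nlinarith [mul_le_mul_of_nonneg_left h hc0]
    _ ≤ ∑ σ : ι → Bool, Real.exp (-c * r) * Real.exp (∑ j, boolSign (σ j) * (c * d j)) :=
        Finset.sum_le_sum_of_subset_of_nonneg (Finset.filter_subset _ _)
          fun _ _ _ => by positivity
    _ = Real.exp (-c * r) * ∏ j, (2 * Real.cosh (c * d j)) := by
        rw [← Finset.mul_sum, sum_exp_boolSign]
    _ ≤ Real.exp (-c * r) * ∏ _j : ι, (2 * Real.exp ((c * D) ^ 2 / 2)) := by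
        refine mul_le_mul_of_nonneg_left (Finset.prod_le_prod (fun j _ => ?_) fun j _ => ?_)
          (Real.exp_pos _).le
        · have := Real.cosh_pos (c * d j)
          positivity
        · have h1 : (c * d j) ^ 2 ≤ (c * D) ^ 2 := by
            rw [mul_pow, mul_pow, ← sq_abs (d j)]
            gcongr
            exact hd j
          have h2 : Real.exp ((c * d j) ^ 2 / 2) ≤ Real.exp ((c * D) ^ 2 / 2) := by gcongr
          linarith [Real.cosh_le_exp_half_sq (c * d j)]
    _ = 2 ^ Fintype.card ι * Real.exp (-r ^ 2 / (2 * n * D ^ 2)) := by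
        rw [Finset.prod_const, mul_pow, Finset.card_univ, ← Real.exp_nat_mul, mul_left_comm,
          ← Real.exp_add, ← hndef]
        congr 2
        rw [hc]
        field_simp
        ring

open Classical in
/-- Hoeffding's inequality for Rademacher sums, as a count of sign patterns. -/
theorem card_le_abs_sum_boolSign [Nonempty ι] {d : ι → ℝ} {D r : ℝ} (hD : 0 < D) (hr : 0 ≤ r)
    (hd : ∀ j, |d j| ≤ D) :
    ((Finset.univ.filter fun σ : ι → Bool => r ≤ |∑ j, boolSign (σ j) * d j|).card : ℝ) ≤
      2 ^ Fintype.card ι * (2 * Real.exp (-r ^ 2 / (2 * Fintype.card ι * D ^ 2))) := by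
  have h1 := card_le_sum_boolSign hD hr hd
  have h2 := card_le_sum_boolSign (d := fun j => -d j) hD hr (fun j => by simpa using hd j)
  have hsub : (Finset.univ.filter fun σ : ι → Bool => r ≤ |∑ j, boolSign (σ j) * d j|) ⊆
      (Finset.univ.filter fun σ : ι → Bool => r ≤ ∑ j, boolSign (σ j) * d j) ∪
      (Finset.univ.filter fun σ : ι → Bool => r ≤ ∑ j, boolSign (σ j) * -d j) := by
    intro σ hσ
    simpa [le_abs] using hσ
  have h3 := (Finset.card_le_card hsub).trans (Finset.card_union_le _ _)
  have h4 := (Nat.cast_le (α := ℝ)).2 h3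
  push_cast at h4
  linarith

end Rademacher

/-! ### Symmetrization for product weights -/

/-- Exchange of sample and ghost sample in the coordinates with sign `-1`. -/
def ghostSwap {ι E : Type*} (σ : ι → Bool) : (ι → E × E) ≃ (ι → E × E) :=
  Equiv.piCongrRight fun j => if σ j then Equiv.refl _ else Equiv.prodComm E E

theorem sub_ghostSwap {ι E : Type*} (g : E → ℝ) (σ : ι → Bool) (y : ι → E × E) (j : ι) :
    g (ghostSwap σ y j).1 - g (ghostSwap σ y j).2 =
      boolSign (σ j) * (g (y j).1 - g (y j).2) := by
  by_cases h : σ j <;> simp [ghostSwap, boolSign, h]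

theorem prod_weight_ghostSwap {ι E : Type*} [Fintype ι] {w : ι → E → ℝ}
    (σ : ι → Bool) (y : ι → E × E) :
    ∏ i, (w i (ghostSwap σ y i).1 * w i (ghostSwap σ y i).2) =
      ∏ i, (w i (y i).1 * w i (y i).2) := by
  refine Finset.prod_congr rfl fun i _ => ?_
  by_cases h : σ i <;> simp [ghostSwap, h, mul_comm]

section Product

variable {ι E : Type*} [Fintype ι] [DecidableEq ι] [Fintype E] {w : ι → E → ℝ}

theorem sum_prod_weight_eq_one (hw1 : ∀ j, ∑ e, w j e = 1) :
    ∑ x : ι → E, ∏ j, w j (x j) = 1 := by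
  rw [← Fintype.prod_sum]
  simp [hw1]

/-- Distinct coordinates are uncorrelated under a product weight. -/
theorem sum_prod_weight_mul_eq_zero {c : ι → E → ℝ} (hc : ∀ j, ∑ e, w j e * c j e = 0)
    {j k : ι} (hjk : j ≠ k) :
    ∑ x : ι → E, (∏ i, w i (x i)) * (c j (x j) * c k (x k)) = 0 := by
  have e : ∀ x : ι → E, (∏ i, w i (x i)) * (c j (x j) * c k (x k)) =
      ∏ i, (w i (x i) * ((if i = j then c i (x i) else 1) * (if i = k then c i (x i) else 1))) := by
    intro x
    rw [Finset.prod_mul_distrib, Finset.prod_mul_distrib, Finset.prod_ite_eq',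
      Finset.prod_ite_eq']
    simp
  simp_rw [e]
  rw [← Fintype.prod_sum (fun i e => w i e *
    ((if i = j then c i e else 1) * (if i = k then c i e else 1)))]
  refine Finset.prod_eq_zero (Finset.mem_univ j) ?_
  simpa [hjk] using hc j

theorem sum_prod_weight_sq_le (hw : ∀ j e, 0 ≤ w j e) (hw1 : ∀ j, ∑ e, w j e = 1)
    {c : ι → E → ℝ} (hc : ∀ j, ∑ e, w j e * c j e = 0) {D : ℝ} (hD : ∀ j e, |c j e| ≤ D) :
    ∑ x : ι → E, (∏ i, w i (x i)) * (∑ j, c j (x j)) ^ 2 ≤ Fintype.card ι * D ^ 2 := by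
  have hW : ∀ x : ι → E, 0 ≤ ∏ i, w i (x i) := fun x => Finset.prod_nonneg fun i _ => hw i _
  calc ∑ x : ι → E, (∏ i, w i (x i)) * (∑ j, c j (x j)) ^ 2
      = ∑ j, ∑ k, ∑ x : ι → E, (∏ i, w i (x i)) * (c j (x j) * c k (x k)) := by
        simp_rw [sq, Finset.sum_mul_sum, Finset.mul_sum]
        rw [Finset.sum_comm]
        exact Finset.sum_congr rfl fun j _ => Finset.sum_comm
    _ = ∑ j, ∑ x : ι → E, (∏ i, w i (x i)) * (c j (x j) * c j (x j)) := by
        refine Finset.sum_congr rfl fun j _ => ?_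
        exact Finset.sum_eq_single j
          (fun k _ hk => sum_prod_weight_mul_eq_zero hc hk.symm) (by simp)
    _ ≤ ∑ j : ι, ∑ x : ι → E, (∏ i, w i (x i)) * D ^ 2 := by
        refine Finset.sum_le_sum fun j _ => Finset.sum_le_sum fun x _ =>
          mul_le_mul_of_nonneg_left ?_ (hW x)
        rw [← sq, ← sq_abs]
        have := hD j (x j)
        gcongr
    _ = Fintype.card ι * D ^ 2 := by
        simp [← Finset.sum_mul, sum_prod_weight_eq_one hw1]

open Classical in
/-- Chebyshev's inequality for a product weight, at a deviation that has probability at least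
one half. -/
theorem half_le_sum_prod_weight (hw : ∀ j e, 0 ≤ w j e) (hw1 : ∀ j, ∑ e, w j e = 1)
    {c : ι → E → ℝ} (hc : ∀ j, ∑ e, w j e * c j e = 0) {D : ℝ} (hD : ∀ j e, |c j e| ≤ D)
    {q : ℝ} (hq : 0 < q) (hqD : 2 * Fintype.card ι * D ^ 2 ≤ q ^ 2) :
    1 / 2 ≤ ∑ x : ι → E with |∑ j, c j (x j)| < q, ∏ i, w i (x i) := by
  have hW : ∀ x : ι → E, 0 ≤ ∏ i, w i (x i) := fun x => Finset.prod_nonneg fun i _ => hw i _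
  have h1 := Finset.sum_filter_add_sum_filter_not Finset.univ
    (fun x : ι → E => |∑ j, c j (x j)| < q) (fun x => ∏ i, w i (x i))
  rw [sum_prod_weight_eq_one hw1] at h1
  have h2 : q ^ 2 * ∑ x : ι → E with ¬ |∑ j, c j (x j)| < q, ∏ i, w i (x i) ≤
      Fintype.card ι * D ^ 2 := by
    refine le_trans ?_ (sum_prod_weight_sq_le hw hw1 hc hD)
    rw [Finset.mul_sum]
    refine (Finset.sum_le_sum fun x hx => ?_).trans
      (Finset.sum_le_sum_of_subset_of_nonneg (Finset.filter_subset _ _)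
        fun x _ _ => mul_nonneg (hW x) (sq_nonneg _))
    rw [mul_comm]
    refine mul_le_mul_of_nonneg_left ?_ (hW x)
    rw [← sq_abs (∑ j, c j (x j))]
    have := not_lt.1 (Finset.mem_filter.1 hx).2
    gcongr
  have hq2 : 0 < q ^ 2 := by positivity
  have h3 : ∑ x : ι → E with ¬ |∑ j, c j (x j)| < q, ∏ i, w i (x i) ≤ 1 / 2 := by
    refine le_of_mul_le_mul_left ?_ hq2
    linarith
  linarith

open Classical in
/-- Comparison with a ghost sample: if some `f` has a large deviation on the sample, then with
probability at least one half the ghost sample has a small deviation for the same `f`. -/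
theorem sum_deviation_le_two_mul_sum_ghost {G : Type*} {F : Set G} {a : G → E → ℝ} {c : G → ℝ}
    {B r : ℝ} (hw : ∀ j e, 0 ≤ w j e) (hw1 : ∀ j, ∑ e, w j e = 1)
    (ha : ∀ f ∈ F, ∀ e, |a f e| ≤ B) (hac : ∀ f ∈ F, ∀ j, ∑ e, w j e * a f e = c f)
    (hr : 0 < r) (hrB : 32 * Fintype.card ι * B ^ 2 ≤ r ^ 2) :
    ∑ x : ι → E with (∃ f ∈ F, r ≤ |∑ j, (a f (x j) - c f)|), ∏ i, w i (x i) ≤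
      2 * ∑ y : ι → E × E with (∃ f ∈ F, r / 2 ≤ |∑ j, (a f (y j).1 - a f (y j).2)|),
        ∏ i, (w i (y i).1 * w i (y i).2) := by
  have hW : ∀ x : ι → E, 0 ≤ ∏ i, w i (x i) := fun x => Finset.prod_nonneg fun i _ => hw i _
  have e : ∑ y : ι → E × E with (∃ f ∈ F, r / 2 ≤ |∑ j, (a f (y j).1 - a f (y j).2)|),
        ∏ i, (w i (y i).1 * w i (y i).2) =
      ∑ x : ι → E, ∑ x' : ι → E with (∃ f ∈ F, r / 2 ≤ |∑ j, (a f (x j) - a f (x' j))|),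
        (∏ i, w i (x i)) * ∏ i, w i (x' i) := by
    simp_rw [Finset.sum_filter]
    rw [← Fintype.sum_prod_type' (f := fun (x x' : ι → E) =>
      if ∃ f ∈ F, r / 2 ≤ |∑ j, (a f (x j) - a f (x' j))| then
        (∏ i, w i (x i)) * ∏ i, w i (x' i) else 0)]
    refine Fintype.sum_equiv (Equiv.arrowProdEquivProdArrow ι (fun _ => E) (fun _ => E)) _ _
      fun y => ?_
    simp [Equiv.arrowProdEquivProdArrow, Finset.prod_mul_distrib]
  rw [e, Finset.mul_sum, Finset.sum_filter]
  refine Finset.sum_le_sum fun x _ => ?_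
  have hnn : 0 ≤ ∑ x' : ι → E with (∃ f ∈ F, r / 2 ≤ |∑ j, (a f (x j) - a f (x' j))|),
      (∏ i, w i (x i)) * ∏ i, w i (x' i) :=
    Finset.sum_nonneg fun x' _ => mul_nonneg (hW x) (hW x')
  split_ifs with hx
  · obtain ⟨f, hf, hfx⟩ := hx
    have hcf : ∀ j : ι, |c f| ≤ B := by
      intro j
      rw [← hac f hf j]
      calc |∑ e, w j e * a f e| ≤ ∑ e, |w j e * a f e| := Finset.abs_sum_le_sum_abs _ _
        _ ≤ ∑ e, w j e * B := by
          refine Finset.sum_le_sum fun e _ => ?_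
          rw [abs_mul, abs_of_nonneg (hw j e)]
          exact mul_le_mul_of_nonneg_left (ha f hf e) (hw j e)
        _ = B := by rw [← Finset.sum_mul, hw1, one_mul]
    have h1 := half_le_sum_prod_weight hw hw1 (c := fun _ e => a f e - c f) (D := 2 * B)
      (q := r / 2) (fun j => by
        simp_rw [mul_sub, Finset.sum_sub_distrib, ← Finset.sum_mul, hac f hf j, hw1]; ring)
      (fun j e => by
        have h1 := abs_le.1 (ha f hf e)
        have h2 := abs_le.1 (hcf j)
        exact abs_le.2 ⟨by linarith, by linarith⟩) (by positivity) (by nlinarith)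
    rw [← Finset.mul_sum]
    have h2 : ∑ x' : ι → E with |∑ j, (a f (x' j) - c f)| < r / 2, ∏ i, w i (x' i) ≤
        ∑ x' : ι → E with (∃ f ∈ F, r / 2 ≤ |∑ j, (a f (x j) - a f (x' j))|),
          ∏ i, w i (x' i) := by
      refine Finset.sum_le_sum_of_subset_of_nonneg (fun x' hx' => ?_) fun x' _ _ => hW x'
      have h3 := (Finset.mem_filter.1 hx').2
      refine Finset.mem_filter.2 ⟨Finset.mem_univ _, f, hf, ?_⟩
      have h4 : ∑ j, (a f (x j) - a f (x' j)) =
          ∑ j, (a f (x j) - c f) - ∑ j, (a f (x' j) - c f) := by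
        rw [← Finset.sum_sub_distrib]
        exact Finset.sum_congr rfl fun j _ => by ring
      rw [h4]
      have := abs_sub_abs_le_abs_sub (∑ j, (a f (x j) - c f)) (∑ j, (a f (x' j) - c f))
      linarith
    nlinarith [hW x]
  · linarith

open Classical in
/-- The double sample is exchangeable in each coordinate, so random signs may be inserted; for a
fixed double sample `F` may be replaced by a finite cover, and Hoeffding's inequality
applies to each element of it. -/
theorem sum_ghost_le [Nonempty ι] {G : Type*} {F : Set G} {a : G → E → ℝ}
    {B r δ : ℝ} {K : ℕ} (hw : ∀ j e, 0 ≤ w j e) (hw1 : ∀ j, ∑ e, w j e = 1) (hB : 0 < B)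
    (ha : ∀ f ∈ F, ∀ e, |a f e| ≤ B) (hδ : 0 ≤ r - 2 * Fintype.card ι * δ)
    (hcov : ∀ y : ι → E × E, ∃ C : Finset G, C.card ≤ K ∧ ↑C ⊆ F ∧ ∀ f ∈ F, ∃ g ∈ C, ∀ j,
      |a f (y j).1 - a g (y j).1| ≤ δ ∧ |a f (y j).2 - a g (y j).2| ≤ δ) :
    ∑ y : ι → E × E with (∃ f ∈ F, r ≤ |∑ j, (a f (y j).1 - a f (y j).2)|),
        ∏ i, (w i (y i).1 * w i (y i).2) ≤
      K * (2 * Real.exp (-(r - 2 * Fintype.card ι * δ) ^ 2 /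
        (2 * Fintype.card ι * (2 * B) ^ 2))) := by
  set W : (ι → E × E) → ℝ := fun y => ∏ i, (w i (y i).1 * w i (y i).2) with hWdef
  set V : ℝ := 2 * Real.exp (-(r - 2 * Fintype.card ι * δ) ^ 2 /
        (2 * Fintype.card ι * (2 * B) ^ 2)) with hV
  have hV0 : 0 ≤ V := by positivity
  have hW : ∀ y, 0 ≤ W y := fun y => Finset.prod_nonneg fun i _ => mul_nonneg (hw i _) (hw i _)
  have hW1 : ∑ y, W y = 1 :=
    sum_prod_weight_eq_one (w := fun i (e : E × E) => w i e.1 * w i e.2) fun j => by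
      rw [Fintype.sum_prod_type]
      simp [← Finset.mul_sum, hw1]
  have h2 : (0 : ℝ) < 2 ^ Fintype.card ι := by positivity
  refine le_of_mul_le_mul_left ?_ h2
  calc 2 ^ Fintype.card ι *
        ∑ y : ι → E × E with (∃ f ∈ F, r ≤ |∑ j, (a f (y j).1 - a f (y j).2)|), W y
      = ∑ _σ : ι → Bool,
        ∑ y : ι → E × E, if ∃ f ∈ F, r ≤ |∑ j, (a f (y j).1 - a f (y j).2)| then W y else 0 := by
        rw [Finset.sum_const, Finset.sum_filter]
        simp
    _ = ∑ σ : ι → Bool, ∑ y : ι → E × E,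
          if ∃ f ∈ F, r ≤ |∑ j, boolSign (σ j) * (a f (y j).1 - a f (y j).2)| then W y else 0 := by
        refine Finset.sum_congr rfl fun σ _ => ?_
        rw [← Equiv.sum_comp (ghostSwap σ)]
        refine Finset.sum_congr rfl fun y _ => ?_
        simp_rw [hWdef, prod_weight_ghostSwap, sub_ghostSwap]
    _ = ∑ y : ι → E × E, W y * ((Finset.univ.filter fun σ : ι → Bool =>
          ∃ f ∈ F, r ≤ |∑ j, boolSign (σ j) * (a f (y j).1 - a f (y j).2)|).card : ℝ) := by
        rw [Finset.sum_comm]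
        refine Finset.sum_congr rfl fun y _ => ?_
        rw [← Finset.sum_filter, Finset.sum_const, nsmul_eq_mul, mul_comm]
    _ ≤ ∑ y : ι → E × E, W y * (2 ^ Fintype.card ι * (K * V)) := by
        refine Finset.sum_le_sum fun y _ => mul_le_mul_of_nonneg_left ?_ (hW y)
        obtain ⟨C, hCK, hCF, hC⟩ := hcov y
        have hsub : (Finset.univ.filter fun σ : ι → Bool =>
            ∃ f ∈ F, r ≤ |∑ j, boolSign (σ j) * (a f (y j).1 - a f (y j).2)|) ⊆
            C.biUnion fun g => Finset.univ.filter fun σ : ι → Bool =>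
              r - 2 * Fintype.card ι * δ ≤
                |∑ j, boolSign (σ j) * (a g (y j).1 - a g (y j).2)| := by
          intro σ hσ
          obtain ⟨f, hf, hfr⟩ := (Finset.mem_filter.1 hσ).2
          obtain ⟨g, hg, hfg⟩ := hC f hf
          refine Finset.mem_biUnion.2 ⟨g, hg, Finset.mem_filter.2 ⟨Finset.mem_univ _, ?_⟩⟩
          have h3 : |∑ j, boolSign (σ j) * (a f (y j).1 - a f (y j).2) -
              ∑ j, boolSign (σ j) * (a g (y j).1 - a g (y j).2)| ≤
              2 * Fintype.card ι * δ := by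
            rw [← Finset.sum_sub_distrib]
            refine (Finset.abs_sum_le_sum_abs _ _).trans ?_
            have h4 : ∀ j ∈ (Finset.univ : Finset ι),
                |boolSign (σ j) * (a f (y j).1 - a f (y j).2) -
                  boolSign (σ j) * (a g (y j).1 - a g (y j).2)| ≤ 2 * δ := by
              intro j _
              have h5 := abs_le.1 (hfg j).1
              have h6 := abs_le.1 (hfg j).2
              rw [← mul_sub, abs_mul]
              have h7 : |boolSign (σ j)| = 1 := by cases σ j <;> simp [boolSign]
              rw [h7, one_mul]
              exact abs_le.2 ⟨by linarith, by linarith⟩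
            refine (Finset.sum_le_sum h4).trans (le_of_eq ?_)
            simp
            ring
          have := abs_sub_abs_le_abs_sub (∑ j, boolSign (σ j) * (a f (y j).1 - a f (y j).2))
            (∑ j, boolSign (σ j) * (a g (y j).1 - a g (y j).2))
          linarith
        have h5 := (Finset.card_le_card hsub).trans Finset.card_biUnion_le
        calc ((Finset.univ.filter fun σ : ι → Bool =>
              ∃ f ∈ F, r ≤ |∑ j, boolSign (σ j) * (a f (y j).1 - a f (y j).2)|).card : ℝ)
            ≤ ∑ g ∈ C, ((Finset.univ.filter fun σ : ι → Bool =>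
              r - 2 * Fintype.card ι * δ ≤
                |∑ j, boolSign (σ j) * (a g (y j).1 - a g (y j).2)|).card : ℝ) := by
              exact_mod_cast h5
          _ ≤ ∑ g ∈ C, 2 ^ Fintype.card ι * V := by
              refine Finset.sum_le_sum fun g hg =>
                card_le_abs_sum_boolSign (by positivity) hδ fun j => ?_
              have h6 := abs_le.1 (ha g (hCF hg) (y j).1)
              have h7 := abs_le.1 (ha g (hCF hg) (y j).2)
              exact abs_le.2 ⟨by linarith, by linarith⟩
          _ ≤ 2 ^ Fintype.card ι * (K * V) := by
              rw [Finset.sum_const, nsmul_eq_mul, mul_left_comm]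
              have : (C.card : ℝ) ≤ K := by exact_mod_cast hCK
              gcongr
    _ = 2 ^ Fintype.card ι * (K * V) := by rw [← Finset.sum_mul, hW1, one_mul]

open Classical in
/-- Uniform deviation inequality for independent, not necessarily identically distributed,
observations with common means. -/
theorem sum_deviation_le [Nonempty ι] {G : Type*} {F : Set G} {a : G → E → ℝ} {c : G → ℝ}
    {B ε : ℝ} {K : ℕ} (hw : ∀ j e, 0 ≤ w j e) (hw1 : ∀ j, ∑ e, w j e = 1) (hB : 0 < B)
    (hε : 0 < ε) (ha : ∀ f ∈ F, ∀ e, |a f e| ≤ B)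
    (hac : ∀ f ∈ F, ∀ j, ∑ e, w j e * a f e = c f)
    (hcard : 32 * B ^ 2 ≤ Fintype.card ι * ε ^ 2)
    (hcov : ∀ y : ι → E × E, ∃ C : Finset G, C.card ≤ K ∧ ↑C ⊆ F ∧ ∀ f ∈ F, ∃ g ∈ C, ∀ j,
      |a f (y j).1 - a g (y j).1| ≤ ε / 16 ∧ |a f (y j).2 - a g (y j).2| ≤ ε / 16) :
    ∑ x : ι → E with (∃ f ∈ F, Fintype.card ι * ε ≤ |∑ j, (a f (x j) - c f)|), ∏ i, w i (x i) ≤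
      8 * K * Real.exp (-(ε ^ 2 * Fintype.card ι) / (128 * B ^ 2)) := by
  have hn : (0 : ℝ) < Fintype.card ι := by exact_mod_cast Fintype.card_pos
  have h1 := sum_deviation_le_two_mul_sum_ghost hw hw1 ha hac (r := Fintype.card ι * ε)
    (by positivity) (by nlinarith)
  have h2 := sum_ghost_le (r := Fintype.card ι * ε / 2) hw hw1 hB ha
    (by nlinarith [mul_pos hn hε]) hcov
  -- The radius `ε / 16` leaves a deviation `3 * ε / 8`, hence the exponent `9 / 512 ≥ 1 / 128`.
  have h3 : Real.exp (-(Fintype.card ι * ε / 2 - 2 * Fintype.card ι * (ε / 16)) ^ 2 /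
        (2 * Fintype.card ι * (2 * B) ^ 2)) ≤
      Real.exp (-(ε ^ 2 * Fintype.card ι) / (128 * B ^ 2)) := by
    refine Real.exp_le_exp.2 ?_
    rw [div_le_div_iff₀ (by positivity) (by positivity)]
    have : 0 ≤ (Fintype.card ι : ℝ) ^ 2 * ε ^ 2 * B ^ 2 := by positivity
    nlinarith
  have h4 : (0 : ℝ) ≤ K := by positivity
  have h5 := Real.exp_pos (-(ε ^ 2 * Fintype.card ι) / (128 * B ^ 2))
  have h6 := mul_le_mul_of_nonneg_left h3 h4
  have h7 := mul_nonneg h4 h5.le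
  linarith

end Product

/-! ### Laws of variables with finitely many values -/

section FiniteLaw

variable {Ω A C : Type*} [Fintype A] [Fintype C] [MeasurableSpace Ω] {μ : Measure Ω}
  [IsProbabilityMeasure μ] {Y : Ω → A}

open Classical in
theorem measureReal_eq_sum_fiber (hY : ∀ a, MeasurableSet {ω | Y ω = a}) (S : A → Prop) :
    μ.real {ω | S (Y ω)} = ∑ a with S a, μ.real {ω | Y ω = a} := by
  have h : {ω | S (Y ω)} = ⋃ a ∈ Finset.univ.filter S, {ω | Y ω = a} := by
    ext ω
    simp
  rw [h, measureReal_biUnion_finset (fun a _ a' _ haa' => ?_) fun a _ => hY a]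
  exact Set.disjoint_left.2 fun ω h1 h2 => haa' (h1.symm.trans h2)

theorem sum_measureReal_fiber_eq_one (hY : ∀ a, MeasurableSet {ω | Y ω = a}) :
    ∑ a, μ.real {ω | Y ω = a} = 1 := by
  classical
  have := measureReal_eq_sum_fiber (μ := μ) hY fun _ => True
  simpa using this.symm

theorem sum_measureReal_fiber_mul_comp (hY : ∀ a, MeasurableSet {ω | Y ω = a}) (φ : A → C)
    (g : C → ℝ) :
    ∑ a, μ.real {ω | Y ω = a} * g (φ a) = ∑ c, μ.real {ω | φ (Y ω) = c} * g c := by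
  classical
  rw [← Finset.sum_fiberwise Finset.univ φ]
  refine Finset.sum_congr rfl fun c _ => ?_
  rw [measureReal_eq_sum_fiber hY fun a => φ a = c, Finset.sum_mul]
  refine Finset.sum_congr rfl fun a ha => ?_
  rw [(Finset.mem_filter.1 ha).2]

end FiniteLaw

open Classical in
/-- Probabilities of an event under two laws differ by at most half the `ℓ¹` distance. -/
theorem sum_filter_le_add_of_sum_abs_sub_le {A : Type*} [Fintype A] {P Q : A → ℝ} {δ : ℝ}
    (hPQ : ∑ a, P a = ∑ a, Q a) (h : ∑ a, |P a - Q a| ≤ 2 * δ) (S : A → Prop) :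
    ∑ a with S a, P a ≤ ∑ a with S a, Q a + δ := by
  have h1 := Finset.sum_filter_add_sum_filter_not Finset.univ S (fun a => P a - Q a)
  have h2 := Finset.sum_filter_add_sum_filter_not Finset.univ S (fun a => |P a - Q a|)
  have h3 : ∑ a with S a, (P a - Q a) ≤ ∑ a with S a, |P a - Q a| :=
    Finset.sum_le_sum fun a _ => le_abs_self _
  have h4 : -∑ a with ¬ S a, (P a - Q a) ≤ ∑ a with ¬ S a, |P a - Q a| := by
    rw [← Finset.sum_neg_distrib]
    exact Finset.sum_le_sum fun a _ => neg_le_abs _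
  rw [Finset.sum_sub_distrib] at h1 h3
  rw [Finset.sum_sub_distrib, Finset.sum_sub_distrib] at h1
  rw [Finset.sum_sub_distrib] at h4
  linarith

/-! ### Decoupling by mixing -/

theorem betaCoeff_nonneg {Ω : Type*} {𝒜 ℬ mΩ : MeasurableSpace Ω} {μ : Measure Ω} :
    0 ≤ betaCoeff 𝒜 ℬ μ := by
  refine Real.sSup_nonneg ?_
  rintro x ⟨I, J, A, C, -, -, rfl⟩
  positivity

theorem betaMixing_nonneg {Ω S : Type*} [MeasurableSpace Ω] {μ : Measure Ω} [MeasurableSpace S]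
    {z : ℕ → Ω → S} (m : ℕ) : 0 ≤ betaMixing μ z m :=
  Real.iSup_nonneg fun _ => betaCoeff_nonneg

section Mixing

variable {Ω : Type*} {mΩ : MeasurableSpace Ω} {μ : Measure Ω} [IsProbabilityMeasure μ]

theorem isMeasPartition_fiber {A : Type*} [Fintype A] {𝒜 : MeasurableSpace Ω} {Y : Ω → A}
    (hY : ∀ a, MeasurableSet[𝒜] {ω | Y ω = a}) :
    IsMeasPartition 𝒜 fun i => {ω | Y ω = (Fintype.equivFin A).symm i} := by
  refine ⟨fun i => hY _, fun i j hij => Set.disjoint_left.2 fun ω h1 h2 => hij ?_, ?_⟩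
  · exact (Fintype.equivFin A).symm.injective (h1.symm.trans h2)
  · exact Set.eq_univ_of_forall fun ω =>
      Set.mem_iUnion.2 ⟨Fintype.equivFin A (Y ω), by simp⟩

theorem sum_abs_fiber_le_two_mul_betaCoeff {A C : Type*} [Fintype A] [Fintype C]
    {𝒜 ℬ : MeasurableSpace Ω} (h𝒜 : 𝒜 ≤ mΩ) (hℬ : ℬ ≤ mΩ) {Y : Ω → A} {Z : Ω → C}
    (hY : ∀ a, MeasurableSet[𝒜] {ω | Y ω = a}) (hZ : ∀ c, MeasurableSet[ℬ] {ω | Z ω = c}) :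
    ∑ a, ∑ c, |μ.real ({ω | Y ω = a} ∩ {ω | Z ω = c}) -
      μ.real {ω | Y ω = a} * μ.real {ω | Z ω = c}| ≤ 2 * betaCoeff 𝒜 ℬ μ := by
  have hbdd : BddAbove (betaSums 𝒜 ℬ μ) := ⟨1, fun x hx => le_one_of_mem_betaSums h𝒜 hℬ hx⟩
  have h := le_csSup hbdd ⟨_, _, _, _, isMeasPartition_fiber hY, isMeasPartition_fiber hZ, rfl⟩
  have e : ∑ a, ∑ c, |μ.real ({ω | Y ω = a} ∩ {ω | Z ω = c}) -
      μ.real {ω | Y ω = a} * μ.real {ω | Z ω = c}| =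
      ∑ i, ∑ j, |μ.real ({ω | Y ω = (Fintype.equivFin A).symm i} ∩
          {ω | Z ω = (Fintype.equivFin C).symm j}) -
        μ.real {ω | Y ω = (Fintype.equivFin A).symm i} *
          μ.real {ω | Z ω = (Fintype.equivFin C).symm j}| := by
    rw [← Equiv.sum_comp (Fintype.equivFin A).symm]
    refine Finset.sum_congr rfl fun i _ => ?_
    rw [← Equiv.sum_comp (Fintype.equivFin C).symm]
  rw [e]
  unfold betaCoeff
  linarith

variable {S : Type*} [MeasurableSpace S] {z : ℕ → Ω → S}

theorem sigmaOf_le (hz : ∀ t, Measurable (z t)) (P : ℕ → Prop) : sigmaOf z P ≤ mΩ :=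
  iSup₂_le fun t _ => (hz t).comap_le

theorem measurableSet_sigmaOf {P : ℕ → Prop} {t : ℕ} (ht : P t) {s : Set S}
    (hs : MeasurableSet s) : MeasurableSet[sigmaOf z P] (z t ⁻¹' s) :=
  (le_iSup₂_of_le (f := fun (s : ℕ) (_ : P s) => MeasurableSpace.comap (z s) inferInstance)
    t ht le_rfl) _ ⟨s, hs, rfl⟩

theorem betaCoeff_le_betaMixing (hz : ∀ t, Measurable (z t)) (m k : ℕ) :
    betaCoeff (sigmaOf z (fun s => s ≤ k)) (sigmaOf z (fun s => k + m ≤ s)) μ ≤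
      betaMixing μ z m := by
  refine le_ciSup (f := fun k =>
    betaCoeff (sigmaOf z (fun s => s ≤ k)) (sigmaOf z (fun s => k + m ≤ s)) μ) ⟨1, ?_⟩ k
  rintro x ⟨k, rfl⟩
  exact Real.sSup_le (fun x hx =>
    le_one_of_mem_betaSums (sigmaOf_le hz _) (sigmaOf_le hz _) hx) zero_le_one

/-- If each variable of a sequence is nearly independent of the preceding ones, then the joint law
of the first `n` is close to the product of their laws: the errors add up. -/
theorem sum_abs_joint_sub_prod_le {E : Type*} [Fintype E] {X : ℕ → Ω → E}
    (hX : ∀ n e, MeasurableSet {ω | X n ω = e}) {β : ℝ}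
    (h : ∀ n, ∑ x : Fin n → E, ∑ e,
      |μ.real ({ω | (fun i : Fin n => X i ω) = x} ∩ {ω | X n ω = e}) -
        μ.real {ω | (fun i : Fin n => X i ω) = x} * μ.real {ω | X n ω = e}| ≤ 2 * β) (n : ℕ) :
    ∑ x : Fin n → E, |μ.real {ω | (fun i : Fin n => X i ω) = x} -
      ∏ i : Fin n, μ.real {ω | X i ω = x i}| ≤ 2 * (n * β) := by
  induction n with
  | zero =>
    have : ∀ x : Fin 0 → E, {ω | (fun i : Fin 0 => X i ω) = x} = Set.univ := fun x =>
      Set.eq_univ_of_forall fun ω => Subsingleton.elim _ _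
    simp [this]
  | succ n ih =>
    rw [← Equiv.sum_comp (Fin.snocEquiv fun _ => E), Fintype.sum_prod_type_right]
    have e : ∀ (x : Fin n → E) (e : E),
        {ω | (fun i : Fin (n + 1) => X i ω) = Fin.snocEquiv (fun _ => E) (e, x)} =
          {ω | (fun i : Fin n => X i ω) = x} ∩ {ω | X n ω = e} := by
      intro x e
      ext ω
      simp only [Set.mem_ofPred_eq, Set.mem_inter_iff, funext_iff, Fin.forall_fin_succ']
      simp [Fin.snocEquiv]
    have e' : ∀ (x : Fin n → E) (e : E),
        ∏ i : Fin (n + 1), μ.real {ω | X i ω = Fin.snocEquiv (fun _ => E) (e, x) i} =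
          (∏ i : Fin n, μ.real {ω | X i ω = x i}) * μ.real {ω | X n ω = e} := by
      intro x e
      rw [Fin.prod_univ_castSucc]
      simp [Fin.snocEquiv]
    simp_rw [e, e']
    have hsum : ∑ x : Fin n → E, ∑ e,
        |μ.real {ω | (fun i : Fin n => X i ω) = x} * μ.real {ω | X n ω = e} -
          (∏ i : Fin n, μ.real {ω | X i ω = x i}) * μ.real {ω | X n ω = e}| =
        ∑ x : Fin n → E, |μ.real {ω | (fun i : Fin n => X i ω) = x} -
          ∏ i : Fin n, μ.real {ω | X i ω = x i}| := by
      refine Finset.sum_congr rfl fun x _ => ?_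
      simp_rw [← sub_mul, abs_mul, abs_of_nonneg measureReal_nonneg]
      rw [← Finset.mul_sum, sum_measureReal_fiber_eq_one (hX n), mul_one]
    calc _ ≤ ∑ x : Fin n → E, ∑ e,
          (|μ.real ({ω | (fun i : Fin n => X i ω) = x} ∩ {ω | X n ω = e}) -
            μ.real {ω | (fun i : Fin n => X i ω) = x} * μ.real {ω | X n ω = e}| +
          |μ.real {ω | (fun i : Fin n => X i ω) = x} * μ.real {ω | X n ω = e} -
            (∏ i : Fin n, μ.real {ω | X i ω = x i}) * μ.real {ω | X n ω = e}|) :=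
          Finset.sum_le_sum fun x _ => Finset.sum_le_sum fun e _ => abs_sub_le _ _ _
      _ ≤ 2 * β + 2 * (n * β) := by
          simp_rw [Finset.sum_add_distrib]
          rw [hsum]
          exact add_le_add (h n) ih
      _ = 2 * ((n + 1 : ℕ) * β) := by push_cast; ring

/-- The `n`-th of the blocks of length `m` that start at time `o` and are separated by gaps of
length `m`. -/
def block (z : ℕ → Ω → S) (m o n : ℕ) (ω : Ω) : Fin m → S :=
  fun i => z (o + 2 * n * m + i) ω

variable [MeasurableSingletonClass S]

theorem measurableSet_block_sigmaOf {P : ℕ → Prop} {m o n : ℕ}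
    (hP : ∀ i < m, P (o + 2 * n * m + i)) (e : Fin m → S) :
    MeasurableSet[sigmaOf z P] {ω | block z m o n ω = e} := by
  have h : {ω | block z m o n ω = e} = ⋂ i : Fin m, z (o + 2 * n * m + i) ⁻¹' {e i} := by
    ext ω
    simp [block, funext_iff]
  rw [h]
  exact @MeasurableSet.iInter _ _ (sigmaOf z P) _ _ fun i =>
    measurableSet_sigmaOf (hP i i.2) (measurableSet_singleton _)

theorem measurableSet_block (hz : ∀ t, Measurable (z t)) {m o n : ℕ} (e : Fin m → S) :
    MeasurableSet {ω | block z m o n ω = e} :=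
  sigmaOf_le hz (fun _ => True) _ (measurableSet_block_sigmaOf (fun _ _ => trivial) e)

theorem sum_abs_blocks_sub_prod_le [Fintype S] (hz : ∀ t, Measurable (z t)) (m o n : ℕ) :
    ∑ x : Fin n → Fin m → S, |μ.real {ω | (fun i : Fin n => block z m o i ω) = x} -
      ∏ i : Fin n, μ.real {ω | block z m o i ω = x i}| ≤ 2 * (n * betaMixing μ z m) := by
  refine sum_abs_joint_sub_prod_le (X := block z m o)
    (fun _ => measurableSet_block hz) (fun n => ?_) n
  rcases Nat.eq_zero_or_pos n with rfl | hn
  · have h0 : ∀ x : Fin 0 → Fin m → S,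
        {ω | (fun i : Fin 0 => block z m o i ω) = x} = Set.univ := fun x =>
      Set.eq_univ_of_forall fun ω => Subsingleton.elim _ _
    simpa [h0] using betaMixing_nonneg (μ := μ) (z := z) m
  -- The blocks before the `n`-th one end before time `o + (2 * n - 1) * m`.
  · obtain ⟨n, rfl⟩ : ∃ k, n = k + 1 := ⟨n - 1, by omega⟩
    refine (sum_abs_fiber_le_two_mul_betaCoeff (μ := μ)
      (sigmaOf_le hz fun s => s ≤ o + (2 * n + 1) * m)
      (sigmaOf_le hz fun s => o + (2 * n + 1) * m + m ≤ s) (fun x => ?_) fun e => ?_).trans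
      (mul_le_mul_of_nonneg_left (betaCoeff_le_betaMixing hz m _) zero_le_two)
    · have h : {ω | (fun i : Fin (n + 1) => block z m o i ω) = x} =
          ⋂ i : Fin (n + 1), {ω | block z m o i ω = x i} := by
        ext ω
        simp [funext_iff]
      rw [h]
      refine @MeasurableSet.iInter _ _ (sigmaOf z _) _ _ fun i =>
        measurableSet_block_sigmaOf (fun k hk => ?_) (x i)
      have h1 : 2 * (i : ℕ) * m ≤ 2 * n * m := by
        have := Nat.lt_succ_iff.1 i.2
        gcongr
      have h2 : (2 * n + 1) * m = 2 * n * m + m := by ring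
      omega
    · refine measurableSet_block_sigmaOf (fun k _ => ?_) e
      have h2 : (2 * n + 1) * m + m = 2 * (n + 1) * m := by ring
      omega

end Mixing

/-! ### Deviations along separated blocks -/

section BlockAverages

variable {Ω S : Type*} {z : ℕ → Ω → S}

/-- Average of `g` over the entries of a block. -/
noncomputable def blockAvg {m : ℕ} (g : S → ℝ) (e : Fin m → S) : ℝ :=
  (1 / (m : ℝ)) * ∑ i, g (e i)

theorem abs_blockAvg_sub_le {m : ℕ} (hm : 0 < m) {g g' : S → ℝ} {e : Fin m → S} {δ : ℝ}
    (h : ∀ i, |g (e i) - g' (e i)| ≤ δ) : |blockAvg g e - blockAvg g' e| ≤ δ := by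
  have hm' : (0 : ℝ) < m := by exact_mod_cast hm
  rw [blockAvg, blockAvg, ← mul_sub, ← Finset.sum_sub_distrib, abs_mul,
    abs_of_pos (by positivity), one_div, inv_mul_le_iff₀ hm']
  refine (Finset.abs_sum_le_sum_abs _ _).trans ((Finset.sum_le_sum fun i _ => h i).trans ?_)
  simp

/-- A time average over `2 * τ * m` steps splits into the averages over the blocks of the two
parities. -/
theorem sum_Icc_eq_sum_blockAvg (g : S → ℝ) {m : ℕ} (hm : 0 < m) (τ : ℕ) (ω : Ω) :
    ∑ t ∈ Finset.Icc 1 (2 * τ * m), g (z t ω) =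
      m * ∑ j : Fin τ, (blockAvg g (block z m 1 j ω) + blockAvg g (block z m (1 + m) j ω)) := by
  have hm' : (m : ℝ) ≠ 0 := by exact_mod_cast hm.ne'
  have h : ∀ n : ℕ, ∑ t ∈ Finset.range (2 * n * m), g (z (1 + t) ω) =
      ∑ j ∈ Finset.range n,
        m * (blockAvg g (block z m 1 j ω) + blockAvg g (block z m (1 + m) j ω)) := by
    intro n
    induction n with
    | zero => simp
    | succ n ih =>
      rw [show 2 * (n + 1) * m = 2 * n * m + (m + m) by ring,
        Finset.sum_range_add (fun t => g (z (1 + t) ω)),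
        Finset.sum_range_add (fun t => g (z (1 + (2 * n * m + t)) ω)), ih,
        Finset.sum_range_succ, Finset.sum_range, Finset.sum_range, Finset.sum_range]
      congr 1
      rw [blockAvg, blockAvg, ← mul_add, ← mul_assoc, mul_one_div_cancel hm', one_mul]
      refine congrArg₂ (· + ·) (Finset.sum_congr rfl fun i _ => ?_)
        (Finset.sum_congr rfl fun i _ => ?_)
      · rw [block, add_assoc]
      · rw [block]
        congr 2
        ring
  have h1 : ∑ t ∈ Finset.Icc 1 (2 * τ * m), g (z t ω) =
      ∑ t ∈ Finset.range (2 * τ * m), g (z (1 + t) ω) := by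
    rw [← Finset.Ico_add_one_right_eq_Icc,
      Finset.sum_Ico_eq_sum_range (fun t => g (z t ω)), Nat.add_sub_cancel]
  rw [h1, h, ← Finset.mul_sum, Finset.sum_range]

end BlockAverages

section Blocks

variable {Ω S G : Type*} [MeasurableSpace Ω] {μ : Measure Ω} [IsProbabilityMeasure μ]
  [Fintype S] [MeasurableSpace S] [MeasurableSingletonClass S] {z : ℕ → Ω → S}

/-- Uniform deviation inequality for the blocks of one parity of a process with equal
marginals. -/
theorem measureReal_block_deviation_le (hz : ∀ t, Measurable (z t)) {π : S → ℝ}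
    (hπ : ∀ t s, μ.real {ω | z t ω = s} = π s) {F : Set G} {a : G → S → ℝ} {B ε : ℝ}
    (hB : 0 < B) (hε : 0 < ε) (ha : ∀ f ∈ F, ∀ s, |a f s| ≤ B) {m τ K : ℕ} (hm : 0 < m)
    (hτ : 0 < τ) (hcard : 32 * B ^ 2 ≤ τ * ε ^ 2)
    (hcov : ∀ v : Fin (2 * τ * m) → S, ∃ C : Finset G, C.card ≤ K ∧ ↑C ⊆ F ∧
      ∀ f ∈ F, ∃ g ∈ C, ∀ t, |a f (v t) - a g (v t)| ≤ ε / 16) (o : ℕ) :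
    μ.real {ω | ∃ f ∈ F, τ * ε ≤
        |∑ j : Fin τ, (blockAvg (a f) (block z m o j ω) - ∑ s, π s * a f s)|} ≤
      8 * K * Real.exp (-(ε ^ 2 * τ) / (128 * B ^ 2)) + τ * betaMixing μ z m := by
  classical
  have : Nonempty (Fin τ) := ⟨⟨0, hτ⟩⟩
  have hm' : (m : ℝ) ≠ 0 := by exact_mod_cast hm.ne'
  set w : Fin τ → (Fin m → S) → ℝ := fun j e => μ.real {ω | block z m o j ω = e} with hw
  have hw1 : ∀ j, ∑ e, w j e = 1 := fun j =>
    sum_measureReal_fiber_eq_one fun e => measurableSet_block hz e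
  have hmeas : ∀ x : Fin τ → Fin m → S,
      MeasurableSet {ω | (fun j : Fin τ => block z m o j ω) = x} := by
    intro x
    have h : {ω | (fun i : Fin τ => block z m o i ω) = x} =
        ⋂ i : Fin τ, {ω | block z m o i ω = x i} := by
      ext ω
      simp [funext_iff]
    rw [h]
    exact MeasurableSet.iInter fun i => measurableSet_block hz _
  have hmean : ∀ f ∈ F, ∀ j, ∑ e, w j e * blockAvg (a f) e = ∑ s, π s * a f s := by
    intro f _ j
    have h1 : ∀ i : Fin m, ∑ e, w j e * a f (e i) = ∑ s, π s * a f s := by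
      intro i
      rw [hw, sum_measureReal_fiber_mul_comp (fun e => measurableSet_block hz e)
        (fun e => e i) (a f)]
      simp_rw [block, hπ]
    have h2 : ∀ e : Fin m → S, w j e * blockAvg (a f) e =
        ∑ i, (1 / (m : ℝ)) * (w j e * a f (e i)) := by
      intro e
      rw [blockAvg, ← Finset.mul_sum, ← Finset.mul_sum]
      ring
    simp_rw [h2]
    rw [Finset.sum_comm]
    simp_rw [← Finset.mul_sum, h1]
    simp [hm']
  have hcov' : ∀ y : Fin τ → (Fin m → S) × (Fin m → S), ∃ C : Finset G, C.card ≤ K ∧ ↑C ⊆ F ∧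
      ∀ f ∈ F, ∃ g ∈ C, ∀ j,
        |blockAvg (a f) (y j).1 - blockAvg (a g) (y j).1| ≤ ε / 16 ∧
        |blockAvg (a f) (y j).2 - blockAvg (a g) (y j).2| ≤ ε / 16 := by
    intro y
    -- Sample and ghost sample together consist of exactly `2 * τ * m` points.
    have eq : Fin τ × Bool × Fin m ≃ Fin (2 * τ * m) :=
      Fintype.equivFinOfCardEq (by simp; ring)
    obtain ⟨C, hCK, hCF, hC⟩ := hcov fun t =>
      if (eq.symm t).2.1 then (y (eq.symm t).1).1 (eq.symm t).2.2
      else (y (eq.symm t).1).2 (eq.symm t).2.2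
    refine ⟨C, hCK, hCF, fun f hf => ?_⟩
    obtain ⟨g, hg, hfg⟩ := hC f hf
    refine ⟨g, hg, fun j => ⟨abs_blockAvg_sub_le hm fun i => ?_,
      abs_blockAvg_sub_le hm fun i => ?_⟩⟩
    · simpa using hfg (eq (j, true, i))
    · simpa using hfg (eq (j, false, i))
  have habs : ∀ f ∈ F, ∀ e : Fin m → S, |blockAvg (a f) e| ≤ B := by
    intro f hf e
    have := abs_blockAvg_sub_le (g' := fun _ => 0) (e := e) hm fun i => by
      simpa using ha f hf (e i)
    simpa [blockAvg] using this
  have key := sum_deviation_le (w := w) (F := F) (a := fun f => blockAvg (a f))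
    (fun _ _ => measureReal_nonneg) hw1 hB hε habs hmean (by simpa using hcard) hcov'
  rw [Fintype.card_fin] at key
  rw [measureReal_eq_sum_fiber hmeas fun x => ∃ f ∈ F, τ * ε ≤
    |∑ j : Fin τ, (blockAvg (a f) (x j) - ∑ s, π s * a f s)|]
  refine (sum_filter_le_add_of_sum_abs_sub_le ?_ (sum_abs_blocks_sub_prod_le hz m o τ) _).trans
    (add_le_add_left key _)
  rw [sum_measureReal_fiber_eq_one hmeas]
  exact (sum_prod_weight_eq_one hw1).symm

end Blocks

/-! ### Stationarity of the lifted chain -/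

section Chain

variable {N : ℕ} {𝔹 ℍ U Ω : Type*}
    [MeasurableSpace 𝔹] [MeasurableSingletonClass 𝔹] [MeasurableSpace ℍ]
    [MeasurableSingletonClass ℍ]
    [MeasurableSpace U] [MeasurableSpace Ω] {μ : Measure Ω} {ν : Measure U}
    {η : Fin N → U → (Fin N → 𝔹) → ℍ} {p : Fin N → ℍ → 𝔹 → PMF 𝔹}
    {u : ℕ → Ω → U} {b : ℕ → Ω → Fin N → 𝔹}

theorem measurableSet_jointFeedback_eq {N : ℕ} {𝔹 ℍ U : Type*} [MeasurableSpace ℍ]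
    [MeasurableSingletonClass ℍ] [MeasurableSpace U] {η : Fin N → U → (Fin N → 𝔹) → ℍ}
    (hη : ∀ i b, Measurable (fun u => η i u b)) (k : Fin N → ℍ) (x : Fin N → 𝔹) :
    MeasurableSet {v | jointFeedback η v x = k} := by
  have h : {v | jointFeedback η v x = k} = ⋂ i, (fun v => η i v x) ⁻¹' {k i} := by
    ext v
    simp [jointFeedback, funext_iff]
  rw [h]
  exact MeasurableSet.iInter fun i => hη i x (measurableSet_singleton _)

theorem lifted_eq_iff {N : ℕ} {𝔹 ℍ U Ω : Type*} {η : Fin N → U → (Fin N → 𝔹) → ℍ}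
    {u : ℕ → Ω → U} {b : ℕ → Ω → Fin N → 𝔹} {t : ℕ} {ω : Ω} {s : State N 𝔹 ℍ} :
    lifted η u b t ω = s ↔
      (jointFeedback η (u t ω) s.2.1 = s.1 ∧ b t ω = s.2.1) ∧ b (t + 1) ω = s.2.2 := by
  obtain ⟨k, x, y⟩ := s
  simp only [lifted, Prod.mk.injEq]
  constructor
  · rintro ⟨h1, h2, h3⟩
    subst h2
    exact ⟨⟨h1, rfl⟩, h3⟩
  · rintro ⟨⟨h1, h2⟩, h3⟩
    subst h2
    exact ⟨h1, rfl, h3⟩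

/-- A conditional probability that is constant on an event `A` of the conditioning σ-algebra is the
conditional probability given `A`. -/
theorem measureReal_inter_of_condExp_eq {Ω : Type*} {𝒢 mΩ : MeasurableSpace Ω} {μ : Measure Ω}
    [IsProbabilityMeasure μ] (h𝒢 : 𝒢 ≤ mΩ) {A D : Set Ω} (hA : MeasurableSet[𝒢] A)
    (hD : MeasurableSet D) {c : ℝ}
    (h : ∀ᵐ ω ∂μ, ω ∈ A → (μ[Set.indicator D (fun _ => (1 : ℝ)) | 𝒢]) ω = c) :
    μ.real (A ∩ D) = c * μ.real A := by
  have h1 := setIntegral_condExp (μ := μ) h𝒢 ((integrable_const (1 : ℝ)).indicator hD) hA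
  rw [setIntegral_congr_ae (g := fun _ => c) (h𝒢 _ hA) h, setIntegral_const,
    integral_indicator_const _ hD, measureReal_restrict_apply hD, Set.inter_comm] at h1
  simp only [smul_eq_mul, mul_one] at h1
  rw [← h1, mul_comm]

/-- The law of `z_t` is determined by the law of `b_t`. -/
theorem IsMCRE.measureReal_lifted_eq [IsProbabilityMeasure μ]
    (hη : ∀ i b, Measurable (fun u => η i u b)) (hb : IsMCRE μ ν η p u b) (t : ℕ)
    (s : State N 𝔹 ℍ) :
    μ.real {ω | lifted η u b t ω = s} = μ.real {ω | b t ω = s.2.1} *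
      (ν.real {v | jointFeedback η v s.2.1 = s.1} * jointTransition p s.1 s.2.1 s.2.2) := by
  set A : Set Ω := u t ⁻¹' {v | jointFeedback η v s.2.1 = s.1} ∩ b t ⁻¹' {s.2.1} with hA
  have hJ := measurableSet_jointFeedback_eq hη s.1 s.2.1
  have hbt : MeasurableSet[sigmaOf b (fun r => r ≤ t)] (b t ⁻¹' {s.2.1}) :=
    measurableSet_sigmaOf (P := fun r => r ≤ t) (le_refl t) (measurableSet_singleton _)
  have hut : MeasurableSet[sigmaOf u (fun r => r ≤ t)]
      (u t ⁻¹' {v | jointFeedback η v s.2.1 = s.1}) :=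
    measurableSet_sigmaOf (P := fun r => r ≤ t) (le_refl t) hJ
  have h1 : {ω | lifted η u b t ω = s} = A ∩ {ω | b (t + 1) ω = s.2.2} := by
    ext ω
    exact lifted_eq_iff
  have h2 : μ.real (A ∩ {ω | b (t + 1) ω = s.2.2}) =
      jointTransition p s.1 s.2.1 s.2.2 * μ.real A := by
    refine measureReal_inter_of_condExp_eq (D := {ω | b (t + 1) ω = s.2.2})
      (sup_le (sigmaOf_le hb.measurable_b _) (sigmaOf_le hb.measurable_u _))
      (MeasurableSet.inter ((le_sup_right (α := MeasurableSpace Ω)) _ hut)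
        ((le_sup_left (α := MeasurableSpace Ω)) _ hbt))
      (hb.measurable_b (t + 1) (measurableSet_singleton _)) ?_
    filter_upwards [hb.transition t s.2.2] with ω hω hωA
    have h5 : b t ω = s.2.1 := hωA.2
    have h6 : jointFeedback η (u t ω) s.2.1 = s.1 := hωA.1
    rw [hω, h5, h6]
  have h7 : μ.real A = ν.real {v | jointFeedback η v s.2.1 = s.1} * μ.real {ω | b t ω = s.2.1} := by
    have h8 := (Indep_iff _ _ μ).1 (hb.indep_u t) _ (b t ⁻¹' {s.2.1})
      ⟨_, hJ, rfl⟩ ((le_sup_left (α := MeasurableSpace Ω)) _ hbt)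
    rw [← hb.law_u t, map_measureReal_apply (hb.measurable_u t) hJ]
    simp only [Measure.real, hA, h8, ENNReal.toReal_mul]
    rfl
  rw [h1, h2, h7]
  ring

variable [Fintype 𝔹] [Fintype ℍ]

theorem IsMCRE.measurable_lifted (hη : ∀ i b, Measurable (fun u => η i u b))
    (hb : IsMCRE μ ν η p u b) (t : ℕ) : Measurable (lifted η u b t) := by
  refine measurable_to_countable' fun s => ?_
  have h : lifted η u b t ⁻¹' {s} =
      (u t ⁻¹' {v | jointFeedback η v s.2.1 = s.1} ∩ b t ⁻¹' {s.2.1}) ∩ b (t + 1) ⁻¹' {s.2.2} := by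
    ext ω
    exact lifted_eq_iff
  rw [h]
  exact ((hb.measurable_u t (measurableSet_jointFeedback_eq hη _ _)).inter
    (hb.measurable_b t (measurableSet_singleton _))).inter
    (hb.measurable_b (t + 1) (measurableSet_singleton _))

theorem IsMCRE.measureReal_lifted_eq_stationary [IsProbabilityMeasure μ]
    (hη : ∀ i b, Measurable (fun u => η i u b)) (hb : IsMCRE μ ν η p u b)
    {π : State N 𝔹 ℍ → ℝ} (hπ : IsStationaryDistribution (liftedMatrix ν η p) π)
    (hz : ∀ x, μ.real {ω | lifted η u b 0 ω = x} = π x) (t : ℕ) (s : State N 𝔹 ℍ) :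
    μ.real {ω | lifted η u b t ω = s} = π s := by
  classical
  induction t generalizing s with
  | zero => exact hz s
  | succ t ih =>
    have h1 : {ω | b (t + 1) ω = s.2.1} = {ω | s.2.1 = (lifted η u b t ω).2.2} := by
      ext ω
      exact eq_comm
    rw [hb.measureReal_lifted_eq hη, h1,
      measureReal_eq_sum_fiber
        (fun x => hb.measurable_lifted hη t (measurableSet_singleton x))
        (fun x : State N 𝔹 ℍ => s.2.1 = x.2.2)]
    simp_rw [ih]
    conv_rhs => rw [← hπ.2]
    rw [Matrix.vecMul, dotProduct, Finset.sum_mul, Finset.sum_filter]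
    refine Finset.sum_congr rfl fun x _ => ?_
    simp [liftedMatrix]

end Chain

/-! ### Covers -/

/-- On every sample there is a cover of size at most the empirical covering number, given by
predictors of the class itself. -/
theorem exists_finset_cover {N : ℕ} {𝔹 ℍ : Type*} [Finite 𝔹] [Finite ℍ] {δ : ℝ} (hδ : 0 ≤ δ)
    (l : (Fin N → 𝔹) → (Fin N → 𝔹) → ℝ) (F : Set (Predictor N 𝔹 ℍ)) {T : ℕ}
    (v : Fin T → State N 𝔹 ℍ) :
    ∃ C : Finset (Predictor N 𝔹 ℍ), C.card ≤ empCoveringNumber δ l F T ∧ ↑C ⊆ F ∧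
      ∀ f ∈ F, ∃ g ∈ C, ∀ t, |lossAt l f (v t) - lossAt l g (v t)| ≤ δ := by
  classical
  have hle : Metric.coveringNumber δ.toNNReal (lossProjection l F v) ≤
      (empCoveringNumber δ l F T : ℕ∞) := by
    rw [coe_empCoveringNumber]
    exact le_iSup (fun z : Fin T → State N 𝔹 ℍ =>
      Metric.coveringNumber δ.toNNReal (lossProjection l F z)) v
  obtain ⟨D, hDF, hDfin, hcov, hcard⟩ :=
    Metric.exists_set_encard_eq_coveringNumber (ne_top_of_le_ne_top (ENat.natCast_ne_top _) hle)
  lift D to Finset (Fin T → ℝ) using hDfin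
  have hc : ∀ d ∈ D, ∃ g ∈ F, (fun t => lossAt l g (v t)) = d := fun d hd => hDF hd
  choose φ hφF hφ using hc
  refine ⟨D.attach.image fun d => φ d.1 d.2, ?_, ?_, fun f hf => ?_⟩
  · rw [← hcard, Set.encard_coe_eq_coe_finsetCard] at hle
    exact Finset.card_image_le.trans (by rw [Finset.card_attach]; exact_mod_cast hle)
  · intro g hg
    obtain ⟨d, -, rfl⟩ := Finset.mem_image.1 (Finset.mem_coe.1 hg)
    exact hφF d.1 d.2
  · obtain ⟨d, hd, hfd⟩ := hcov (Set.mem_image_of_mem (fun f t => lossAt l f (v t)) hf)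
    refine ⟨φ d hd, Finset.mem_image.2 ⟨⟨d, hd⟩, Finset.mem_attach _ _, rfl⟩, fun t => ?_⟩
    have h1 : edist (fun t => lossAt l f (v t)) d ≤ δ.toNNReal := hfd
    rw [edist_le_coe, ← NNReal.coe_le_coe, coe_nndist, Real.coe_toNNReal _ hδ] at h1
    have h2 := (dist_le_pi_dist (fun t => lossAt l f (v t)) d t).trans h1
    rw [Real.dist_eq, ← congrFun (hφ d hd) t] at h2
    exact h2

theorem one_le_empCoveringNumber {N : ℕ} {𝔹 ℍ : Type*} [Finite 𝔹] [Finite ℍ] {δ : ℝ}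
    (hδ : 0 ≤ δ) (l : (Fin N → 𝔹) → (Fin N → 𝔹) → ℝ) {F : Set (Predictor N 𝔹 ℍ)}
    (hF : F.Nonempty) {T : ℕ} (v : Fin T → State N 𝔹 ℍ) : 1 ≤ empCoveringNumber δ l F T := by
  obtain ⟨C, hC, -, h⟩ := exists_finset_cover hδ l F v
  obtain ⟨f, hf⟩ := hF
  obtain ⟨g, hg, -⟩ := h f hf
  exact (Nat.succ_le_of_lt (Finset.card_pos.2 ⟨g, hg⟩)).trans hC

end ABP

/-! ### The uniform convergence bound -/

theorem mainTheorem1 {N : ℕ} {𝔹 ℍ U Ω : Type*}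
    [Fintype 𝔹] [MeasurableSpace 𝔹] [MeasurableSingletonClass 𝔹]
    [Fintype ℍ] [MeasurableSpace ℍ] [MeasurableSingletonClass ℍ]
    [MeasurableSpace U] [MeasurableSpace Ω]
    (μ : Measure Ω) [IsProbabilityMeasure μ] (ν : Measure U) [IsProbabilityMeasure ν]
    (η : Fin N → U → (Fin N → 𝔹) → ℍ) (hη : ∀ i b, Measurable (fun u => η i u b))
    (p : Fin N → ℍ → 𝔹 → PMF 𝔹)
    (u : ℕ → Ω → U) (b : ℕ → Ω → Fin N → 𝔹) (hb : ABP.IsMCRE μ ν η p u b)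
    (π : ABP.State N 𝔹 ℍ → ℝ)
    (hπ : ABP.IsStationaryDistribution (ABP.liftedMatrix ν η p) π)
    (hz : ∀ x, μ.real {ω | ABP.lifted η u b 0 ω = x} = π x)
    (l : (Fin N → 𝔹) → (Fin N → 𝔹) → ℝ) (F : Set (ABP.Predictor N 𝔹 ℍ))
    (B : ℝ) (hB : 0 < B) (hl : ∀ f ∈ F, ∀ z, |ABP.lossAt l f z| ≤ B)
    (ε : ℝ) (hε : 0 < ε) (m τ T : ℕ) (hm : 0 < m) (hτ : 0 < τ) (hT : 2 * τ * m = T) :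
    μ.real {ω | ε ≤ ⨆ f : F, |ABP.empiricalRisk l T (fun t => ABP.lifted η u b t ω) f
        - ABP.expectedRisk l π f|}
      ≤ 16 * (ABP.empCoveringNumber (ε / 16) l F T : ℝ) * Real.exp (-(ε ^ 2 * τ) / (128 * B ^ 2))
        + 2 * τ * ABP.betaMixing μ (ABP.lifted η u b) m := by
  subst hT
  have hτ' : (0 : ℝ) < τ := by exact_mod_cast hτ
  have hm' : (0 : ℝ) < m := by exact_mod_cast hm
  have hβ := ABP.betaMixing_nonneg (μ := μ) (z := ABP.lifted η u b) m
  rcases F.eq_empty_or_nonempty with rfl | hF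
  · have h0 : ∀ ω, ¬ ε ≤ ⨆ f : (∅ : Set (ABP.Predictor N 𝔹 ℍ)),
        |ABP.empiricalRisk l (2 * τ * m) (fun t => ABP.lifted η u b t ω) f
          - ABP.expectedRisk l π f| := fun ω => by
      rw [Real.iSup_of_isEmpty]
      exact not_le.2 hε
    simp only [h0, Set.ofPred_false, measureReal_empty]
    positivity
  -- The state space is inhabited, because `Ω` is.
  have hΩ : Nonempty Ω := nonempty_of_isProbabilityMeasure μ
  have hK : (1 : ℝ) ≤ ABP.empCoveringNumber (ε / 16) l F (2 * τ * m) := by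
    exact_mod_cast ABP.one_le_empCoveringNumber (by positivity) l hF
      fun _ => ABP.lifted η u b 0 hΩ.some
  rcases lt_or_ge (τ * ε ^ 2) (32 * B ^ 2) with hsmall | hlarge
  -- For small `τ` the right-hand side exceeds `1`.
  · have h1 : -(1 / 4) ≤ -(ε ^ 2 * τ) / (128 * B ^ 2) := by
      rw [le_div_iff₀ (by positivity)]
      linarith
    have h2 := Real.add_one_le_exp (-(ε ^ 2 * τ) / (128 * B ^ 2))
    have h3 : (3 : ℝ) / 4 ≤ Real.exp (-(ε ^ 2 * τ) / (128 * B ^ 2)) := by linarith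
    have h4 : (1 : ℝ) * (3 / 4) ≤ ABP.empCoveringNumber (ε / 16) l F (2 * τ * m) *
        Real.exp (-(ε ^ 2 * τ) / (128 * B ^ 2)) := by gcongr
    have h5 : 0 ≤ 2 * τ * ABP.betaMixing μ (ABP.lifted η u b) m := by positivity
    refine measureReal_le_one.trans ?_
    linarith
  have hmeas := hb.measurable_lifted hη
  have key := fun o => ABP.measureReal_block_deviation_le (F := F) (a := ABP.lossAt l)
    (z := ABP.lifted η u b) hmeas (hb.measureReal_lifted_eq_stationary hη hπ hz) hB hε hl hm hτ
    hlarge (fun v => ABP.exists_finset_cover (by positivity) l F v) o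
  have hsub : {ω | ε ≤ ⨆ f : F, |ABP.empiricalRisk l (2 * τ * m)
        (fun t => ABP.lifted η u b t ω) f - ABP.expectedRisk l π f|} ⊆
      {ω | ∃ f ∈ F, τ * ε ≤ |∑ j : Fin τ, (ABP.blockAvg (ABP.lossAt l f)
        (ABP.block (ABP.lifted η u b) m 1 j ω) - ∑ s, π s * ABP.lossAt l f s)|} ∪
      {ω | ∃ f ∈ F, τ * ε ≤ |∑ j : Fin τ, (ABP.blockAvg (ABP.lossAt l f)
        (ABP.block (ABP.lifted η u b) m (1 + m) j ω) - ∑ s, π s * ABP.lossAt l f s)|} := by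
    intro ω hω
    have : Nonempty F := hF.to_subtype
    obtain ⟨⟨f, hf⟩, hfmax⟩ := exists_eq_ciSup_of_finite (f := fun f : F =>
      |ABP.empiricalRisk l (2 * τ * m) (fun t => ABP.lifted η u b t ω) f
        - ABP.expectedRisk l π f|)
    have hfε : ε ≤ |ABP.empiricalRisk l (2 * τ * m) (fun t => ABP.lifted η u b t ω) f
        - ABP.expectedRisk l π f| := (show ε ≤ _ from hω).trans hfmax.ge
    by_contra hcon
    simp only [Set.mem_union, Set.mem_ofPred_eq, not_or, not_exists, not_and, not_le] at hcon
    have h1 := hcon.1 f hf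
    have h2 := hcon.2 f hf
    have h3 : ABP.empiricalRisk l (2 * τ * m) (fun t => ABP.lifted η u b t ω) f
        - ABP.expectedRisk l π f = (1 / (2 * τ)) *
        (∑ j : Fin τ, (ABP.blockAvg (ABP.lossAt l f)
          (ABP.block (ABP.lifted η u b) m 1 j ω) - ∑ s, π s * ABP.lossAt l f s) +
        ∑ j : Fin τ, (ABP.blockAvg (ABP.lossAt l f)
          (ABP.block (ABP.lifted η u b) m (1 + m) j ω) - ∑ s, π s * ABP.lossAt l f s)) := by
      rw [ABP.empiricalRisk, ABP.sum_Icc_eq_sum_blockAvg _ hm, ABP.expectedRisk]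
      simp only [Finset.sum_sub_distrib, Finset.sum_add_distrib, Finset.sum_const,
        Finset.card_univ, Fintype.card_fin, nsmul_eq_mul]
      push_cast
      field_simp
      ring
    rw [h3, abs_mul, abs_of_pos (by positivity), one_div, le_inv_mul_iff₀ (by positivity)] at hfε
    have h4 := hfε.trans (abs_add_le _ _)
    linarith
  refine (measureReal_mono hsub).trans ((measureReal_union_le _ _).trans ?_)
  have k1 := key 1
  have k2 := key (1 + m)
  linarith
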